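/- Let $G=(V,E)$ be a finite directed graph with weights $C_{ij}>0$ for $(i,j)\in E$ and $C_{ij}=0$ for $(i,j)\notin E$. For $x\in\mathbb{R}^V$ let $\|x\|_H=\max_{i,j}(x_i-x_j)$ (Hopf's oscillation seminorm), and let $$h(C)=-\min_{i\neq j}\Big(C_{ij}+C_{ji}+\sum_{k\notin\{i,j\}}\min(C_{ik},C_{jk})\Big)$$ (with $h(C)=0$ if $G$ has fewer than two vertices). For differentiable maps $\gamma_{ik}:\mathbb{R}\to\mathbb{R}$, $(i,k)\in E$, consider the nonlinear consensus protocol $$\dot x_i=\sum_{k:\,(i,k)\in E}C_{ik}\,\gamma_{ik}(x_k-x_i),\qquad i\in V, \tag{1}$$ and assume that $\sum_{k:(i,k)\in E}C_{ik}\gamma_{ik}(0)$ does not depend on $i$, i.e. that the line of consensus states is invariant (for example, $\gamma_{ik}(0)=0$ for all arcs). (a) Let $w>0$ and $\alpha\ge 0$ be such that $\gamma_{ik}'(t)\ge\alpha$ for all $t\in[-w,w]$ and $(i,k)\in E$ (for example, $\alpha=\inf\{\gamma_{ik}'(t): t\in[-w,w],\ (i,k)\in E\}$ if $E\ne\emptyset$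 and this infimum is nonnegative). If $\|x(0)\|_H<w$, then (1) has a unique solution with initial value $x(0)$, it is defined for all $t\ge 0$, and $$\|x(t)\|_H\le e^{h(C)\alpha t}\|x(0)\|_H,\qquad t\ge 0.$$ (b) For the Kuramoto equation $\dot\theta_i=\sum_{k:(i,k)\in E}C_{ik}\sin(\theta_k-\theta_i)$, under either of the two conditions below on $\theta(0)$ there is a unique solution with initial value $\theta(0)$, it is defined for all $t\ge0$, and, for all $t\ge 0$, $$\|\theta(t)\|_H\le e^{h(C)\cos(w)t}\|\theta(0)\|_H\quad\text{if } 0<w<\pi/2 \text{ and } \|\theta(0)\|_H<w,$$ $$\|\theta(t)\|_H\le e^{h(C)\cos(\|\theta(0)\|_H)t}\|\theta(0)\|_H\quad\text{if } \theta(0)\in(-\pi/4,\pi/4)^V.$$ (c) For $\dot x_i=\sum_{k:(i,k)\in E}C_{ik}\arctan(x_k-x_i)$ and every $x(0)\in\mathbb{R}^V$, the unique solution is defined for all $t\ge0$ and satisfies $$\|x(t)\|_H\le \exp\Big(\frac{h(C)}{1+\|x(0)\|_H^2}\,t\Big)\|x(0)\|_H,\qquad t\ge 0.$$ -/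

import Mathlib

namespace NonlinearConsensus

noncomputable section

variable {V : Type*} [Fintype V]

/-- Hopf's oscillation seminorm on `ℝ^V` with respect to the unit vector `(1, …, 1)`:
`‖x‖_H = max_{i,j} (x_i - x_j)`. -/
def hopfSeminorm (x : V → ℝ) : ℝ :=
  ⨆ p : V × V, (x p.1 - x p.2)

open Classical in
/-- The functional
`h(A) = - min_{i ≠ j} (A_ij + A_ji + ∑_{k ∉ {i,j}} min (A_ik, A_jk))` on square matrices
(the diagonal entries play no role). -/
def contractionRate (A : Matrix V V ℝ) : ℝ :=
  -⨅ p : {p : V × V // p.1 ≠ p.2},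
    (A p.1.1 p.1.2 + A p.1.2 p.1.1 +
      ∑ k ∈ Finset.univ.filter (fun k => k ≠ p.1.1 ∧ k ≠ p.1.2),
        min (A p.1.1 k) (A p.1.2 k))

open Classical in
/-- The vector field of the consensus protocol
`ẋ_i = ∑_{k : (i,k) ∈ E} C_ik γ_ik(x_k - x_i)`. -/
def consensusField (G : Digraph V) (C : Matrix V V ℝ) (γ : V → V → ℝ → ℝ)
    (x : V → ℝ) : V → ℝ :=
  fun i => ∑ k ∈ Finset.univ.filter (fun k => G.Adj i k), C i k * γ i k (x k - x i)

/-- The initial value problem `ẋ = φ(x)`, `x(0) = x₀` has a solution on `[0, ∞)`, every solution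
on an interval `[0, T)` is a restriction of it, and it satisfies
`‖x(t)‖_H ≤ e^{r t} ‖x₀‖_H` for all `t ≥ 0`. -/
def SolutionContractsAtRate (φ : (V → ℝ) → V → ℝ) (x₀ : V → ℝ) (r : ℝ) : Prop :=
  ∃ x : ℝ → V → ℝ,
    x 0 = x₀ ∧
    IsIntegralCurveOn x (fun _ => φ) (Set.Ici 0) ∧
    (∀ (T : ℝ) (y : ℝ → V → ℝ), y 0 = x₀ →
      IsIntegralCurveOn y (fun _ => φ) (Set.Ico 0 T) → Set.EqOn y x (Set.Ico 0 T)) ∧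
    ∀ t : ℝ, 0 ≤ t → hopfSeminorm (x t) ≤ Real.exp (r * t) * hopfSeminorm x₀

end

end NonlinearConsensus

namespace NonlinearConsensus

open Set Filter Topology

/-! ### Existence and uniqueness for dissipative fields. -/

section Dissipative

variable {V : Type*} [Fintype V]

/-! At a pair `(i, j)` realising the oscillation, `x i` is maximal and `x j` minimal, so the slope
bound compares the nonlinear field with `α` times the linear one. The constants `γ i k 0` cancel by
invariance of the consensus line, and the linear part contracts at rate `contractionRate C`.
Grönwall over all pairs gives the decay (`hopfSeminorm_le_exp_of_isIntegralCurveOn`).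

Since `γ` is only differentiable, the field need not be locally Lipschitz. Instead, `clamp` makes
`γ` monotone on the whole line, and the clamped field is dissipative. Dissipativity gives
uniqueness, and makes the solutions of Lipschitz approximations a Cauchy sequence, hence existence.
The decay estimate with `α = 0` confines the solution to the region where clamping changes nothing.
The rates at the initial oscillation itself come from letting `w` decrease to it. -/

/-- Grönwall's inequality for the maximum of finitely many functions: only the derivatives of the
functions that attain the maximum have to be controlled. -/
theorem le_gronwallBound_of_active {ι : Type*} [Fintype ι] {u u' : ι → ℝ → ℝ} {δ K ε T : ℝ}
    (hc : ∀ q, ContinuousOn (u q) (Icc 0 T))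
    (hd : ∀ q, ∀ t ∈ Ico 0 T, HasDerivWithinAt (u q) (u' q t) (Ici t) t)
    (h0 : ∀ q, u q 0 ≤ δ)
    (hb : ∀ t ∈ Ico 0 T, ∀ q, (∀ p, u p t ≤ u q t) → u' q t ≤ K * u q t + ε)
    {t : ℝ} (ht : t ∈ Icc 0 T) (q : ι) : u q t ≤ gronwallBound δ K ε t := by
  have hne : Nonempty ι := ⟨q⟩
  set f : ℝ → ℝ := fun s => Finset.univ.sup' Finset.univ_nonempty (fun p => u p s) with hf
  have hle : ∀ p s, u p s ≤ f s := fun p s =>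
    Finset.le_sup' (fun p => u p s) (Finset.mem_univ p)
  have hfc : ContinuousOn f (Icc 0 T) :=
    ContinuousOn.finset_sup'_apply Finset.univ_nonempty (fun p _ => hc p)
  have key := le_gronwallBound_of_liminf_deriv_right_le (f := f) (f' := fun s => K * f s + ε)
    (δ := δ) (K := K) (ε := ε) (a := 0) (b := T) hfc ?_
    (Finset.sup'_le _ _ fun p _ => h0 p) (fun _ _ => le_rfl) t ht
  · rw [sub_zero] at key
    exact (hle q t).trans key
  · intro s hs r hr
    -- An index attaining the maximum is controlled by its derivative; any other stays below by
    -- continuity.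
    have hev : ∀ p, ∀ᶠ z in 𝓝[>] s, u p z < f s + r * (z - s) := by
      intro p
      rcases (hle p s).eq_or_lt with h | h
      · have hact : u' p s < r := by
          refine (hb s hs p fun p' => h ▸ hle p' s).trans_lt ?_
          rwa [h]
        have hslope := ((hd p s hs).mono Ioi_subset_Ici_self).limsup_slope_le'
          self_notMem_Ioi hact
        filter_upwards [hslope, self_mem_nhdsWithin] with z hz hzs
        have hpos : 0 < z - s := sub_pos.2 hzs
        rw [slope_def_field, div_lt_iff₀ hpos] at hz
        linarith
      · have h1 : Tendsto (u p) (𝓝[>] s) (𝓝 (u p s)) :=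
          ((hd p s hs).continuousWithinAt.mono Ioi_subset_Ici_self)
        have h2 : Tendsto (fun z => f s + r * (z - s)) (𝓝[>] s) (𝓝 (f s)) := by
          have : Continuous fun z => f s + r * (z - s) := by fun_prop
          simpa using (this.tendsto s).mono_left nhdsWithin_le_nhds
        exact h1.eventually_lt h2 h
    refine Eventually.frequently ?_
    filter_upwards [eventually_all.2 hev, self_mem_nhdsWithin] with z hz hzs
    have hpos : 0 < z - s := sub_pos.2 hzs
    have : f z < f s + r * (z - s) := (Finset.sup'_lt_iff _).2 fun p _ => hz p
    rw [inv_mul_lt_iff₀ hpos]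
    linarith

/-- A vector field on `ℝ^V` is dissipative for the maximum norm if at every index at which
`x - y` is maximal, the field does not increase this difference. -/
def IsDissipative (F : (V → ℝ) → V → ℝ) : Prop :=
  ∀ x y i, (∀ j, x j - y j ≤ x i - y i) → F x i ≤ F y i

/-- Where `x i - y i` is maximal, the contribution of `F` is nonpositive, so only the defects `ε`
and `δ` let the maximum grow. No Lipschitz constant enters. -/
theorem IsDissipative.norm_sub_le {F : (V → ℝ) → V → ℝ} (hF : IsDissipative F)
    {x y x' y' : ℝ → V → ℝ} {T ε δ : ℝ} (hxc : ContinuousOn x (Icc 0 T))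
    (hyc : ContinuousOn y (Icc 0 T))
    (hx : ∀ t ∈ Ico 0 T, HasDerivWithinAt x (x' t) (Ici t) t)
    (hy : ∀ t ∈ Ico 0 T, HasDerivWithinAt y (y' t) (Ici t) t)
    (hxF : ∀ t ∈ Ico 0 T, ‖x' t - F (x t)‖ ≤ ε) (hyF : ∀ t ∈ Ico 0 T, ‖y' t - F (y t)‖ ≤ δ)
    (h0 : x 0 = y 0) {t : ℝ} (ht : t ∈ Icc 0 T) (hε : 0 ≤ ε) (hδ : 0 ≤ δ) :
    ‖x t - y t‖ ≤ (ε + δ) * t := by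
  have main : ∀ {x y x' y' : ℝ → V → ℝ} {ε δ : ℝ}, ContinuousOn x (Icc 0 T) →
      ContinuousOn y (Icc 0 T) → (∀ t ∈ Ico 0 T, HasDerivWithinAt x (x' t) (Ici t) t) →
      (∀ t ∈ Ico 0 T, HasDerivWithinAt y (y' t) (Ici t) t) →
      (∀ t ∈ Ico 0 T, ‖x' t - F (x t)‖ ≤ ε) → (∀ t ∈ Ico 0 T, ‖y' t - F (y t)‖ ≤ δ) →
      x 0 = y 0 → ∀ i, x t i - y t i ≤ (ε + δ) * t := by
    intro x y x' y' ε δ hxc hyc hx hy hxF hyF h0 i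
    have := le_gronwallBound_of_active (u := fun i t => x t i - y t i)
      (u' := fun i t => x' t i - y' t i) (δ := 0) (K := 0) (ε := ε + δ)
      (fun i => ((continuous_apply i).comp_continuousOn hxc).sub
        ((continuous_apply i).comp_continuousOn hyc))
      (fun i s hs => (hasDerivWithinAt_pi.1 (hx s hs) i).sub (hasDerivWithinAt_pi.1 (hy s hs) i))
      (fun i => by simp [h0]) ?_ ht i
    · simpa [gronwallBound_K0] using this
    · intro s hs j hj
      have h1 := hF (x s) (y s) j hj
      have h2 := (abs_le.1 ((norm_le_pi_norm _ j).trans (hxF s hs))).2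
      have h3 := (abs_le.1 ((norm_le_pi_norm _ j).trans (hyF s hs))).1
      simp only [Pi.sub_apply] at h2 h3
      linarith
  refine (pi_norm_le_iff_of_nonneg (mul_nonneg (add_nonneg hε hδ) ht.1)).2 fun i => ?_
  rw [Real.norm_eq_abs, abs_le]
  have h1 := main hxc hyc hx hy hxF hyF h0 i
  have h2 := main hyc hxc hy hx hyF hxF h0.symm i
  simp only [Pi.sub_apply]
  constructor <;> linarith

theorem hasDerivWithinAt_Ici_of_Icc {E : Type*} [NormedAddCommGroup E] [NormedSpace ℝ E]
    {x : ℝ → E} {v : E} {T t : ℝ} (ht : t ∈ Ico 0 T) (h : HasDerivWithinAt x v (Icc 0 T) t) :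
    HasDerivWithinAt x v (Ici t) t :=
  h.mono_of_mem_nhdsWithin (mem_of_superset (Icc_mem_nhdsGE ht.2) (Icc_subset_Icc_left ht.1))

theorem IsDissipative.eqOn_Icc {F : (V → ℝ) → V → ℝ} (hF : IsDissipative F)
    {x y : ℝ → V → ℝ} {T : ℝ} (hx : IsIntegralCurveOn x (fun _ => F) (Icc 0 T))
    (hy : IsIntegralCurveOn y (fun _ => F) (Icc 0 T)) (h0 : x 0 = y 0) :
    EqOn x y (Icc 0 T) := by
  intro t ht
  have := hF.norm_sub_le (ε := 0) (δ := 0) hx.continuousOn hy.continuousOn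
    (fun s hs => hasDerivWithinAt_Ici_of_Icc hs (hx s (Ico_subset_Icc_self hs)))
    (fun s hs => hasDerivWithinAt_Ici_of_Icc hs (hy s (Ico_subset_Icc_self hs)))
    (by simp) (by simp) h0 ht le_rfl le_rfl
  rw [add_zero, zero_mul, norm_le_zero_iff, sub_eq_zero] at this
  exact this

theorem exists_isIntegralCurveOn_Icc_of_lipschitz {E : Type*} [NormedAddCommGroup E]
    [NormedSpace ℝ E] [CompleteSpace E] {F : E → E} {K : NNReal} (hF : LipschitzWith K F) {M : ℝ}
    (hM : ∀ x, ‖F x‖ ≤ M) (x₀ : E) {T : ℝ} (hT : 0 ≤ T) :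
    ∃ x : ℝ → E, x 0 = x₀ ∧ IsIntegralCurveOn x (fun _ => F) (Icc 0 T) := by
  have hM0 : 0 ≤ M := (norm_nonneg _).trans (hM x₀)
  -- A ball of radius `M * T` cannot be left before time `T`, so the local theorem covers all of
  -- `[0, T]`.
  have hPL : IsPicardLindelof (fun _ : ℝ => F) (tmin := 0) (tmax := T) ⟨0, le_rfl, hT⟩ x₀
      (M.toNNReal * T.toNNReal) 0 M.toNNReal K :=
    { lipschitzOnWith := fun _ _ => hF.lipschitzOnWith
      continuousOn := fun _ _ => continuousOn_const
      norm_le := fun _ _ x _ => (hM x).trans (Real.le_coe_toNNReal M)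
      mul_max_le := by simp [hT] }
  exact hPL.exists_eq_forall_mem_Icc_hasDerivWithinAt₀

/-- A bounded continuous dissipative field which is a uniform limit of Lipschitz fields has
solutions on `[0, T]`. -/
theorem IsDissipative.exists_isIntegralCurveOn_Icc {F : (V → ℝ) → V → ℝ} (hF : IsDissipative F)
    (hFc : Continuous F) {M : ℝ} (hM : ∀ x, ‖F x‖ ≤ M)
    (happ : ∀ ε > 0, ∃ (K : NNReal) (H : (V → ℝ) → V → ℝ), LipschitzWith K H ∧
      ∀ x, ‖H x - F x‖ ≤ ε)
    (x₀ : V → ℝ) {T : ℝ} (hT : 0 ≤ T) :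
    ∃ x : ℝ → V → ℝ, x 0 = x₀ ∧ IsIntegralCurveOn x (fun _ => F) (Icc 0 T) := by
  set e : ℕ → ℝ := fun n => 1 / ((n : ℝ) + 1) with he
  have he0 : ∀ n, 0 < e n := fun n => Nat.one_div_pos_of_nat
  have he1 : ∀ n, e n ≤ 1 := fun n => by
    rw [he, div_le_one (by positivity)]
    linarith [(Nat.cast_nonneg n : (0 : ℝ) ≤ n)]
  have hlim : Tendsto e atTop (𝓝 0) := tendsto_one_div_add_atTop_nhds_zero_nat
  choose K H hHL hHF using fun n => happ (e n) (he0 n)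
  have hHM : ∀ n x, ‖H n x‖ ≤ M + 1 := fun n x => by
    have := norm_add_le (F x) (H n x - F x)
    rw [add_sub_cancel] at this
    linarith [hM x, hHF n x, he1 n]
  choose z hz0 hz using fun n =>
    exists_isIntegralCurveOn_Icc_of_lipschitz (hHL n) (hHM n) x₀ hT
  -- Each `z n` solves the equation of `F` up to defect `e n`; the constants `K n`, possibly
  -- unbounded, play no role.
  have hdist : ∀ n m, ∀ t ∈ Icc 0 T, ‖z n t - z m t‖ ≤ (e n + e m) * T := fun n m t ht =>
    (hF.norm_sub_le (hz n).continuousOn (hz m).continuousOn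
      (fun s hs => hasDerivWithinAt_Ici_of_Icc hs (hz n s (Ico_subset_Icc_self hs)))
      (fun s hs => hasDerivWithinAt_Ici_of_Icc hs (hz m s (Ico_subset_Icc_self hs)))
      (fun s _ => hHF n _) (fun s _ => hHF m _) ((hz0 n).trans (hz0 m).symm) ht
      (he0 n).le (he0 m).le).trans
    (mul_le_mul_of_nonneg_left ht.2 (add_pos (he0 n) (he0 m)).le)
  have hcauchy : UniformCauchySeqOn z atTop (Icc 0 T) := by
    rw [Metric.uniformCauchySeqOn_iff]
    intro η hη
    have h2 : Tendsto (fun n => e n * T) atTop (𝓝 0) := by simpa using hlim.mul_const T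
    obtain ⟨N, hN⟩ := eventually_atTop.1 (h2.eventually_lt_const (half_pos hη))
    refine ⟨N, fun m hm n hn t ht => ?_⟩
    rw [dist_eq_norm]
    linarith [hdist m n t ht, hN m hm, hN n hn, add_mul (e m) (e n) T]
  have hpt : ∀ t, ∃ v, t ∈ Icc 0 T → Tendsto (fun n => z n t) atTop (𝓝 v) := fun t => by
    by_cases ht : t ∈ Icc 0 T
    · obtain ⟨v, hv⟩ := cauchySeq_tendsto_of_complete (hcauchy.cauchySeq ht)
      exact ⟨v, fun _ => hv⟩
    · exact ⟨0, fun h => absurd h ht⟩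
  choose x hx using hpt
  have hunif := hcauchy.tendstoUniformlyOn_of_tendsto hx
  have hxc : ContinuousOn x (Icc 0 T) :=
    hunif.continuousOn (Frequently.of_forall fun n => (hz n).continuousOn)
  have hx0 : x 0 = x₀ := tendsto_nhds_unique (hx 0 ⟨le_rfl, hT⟩) (by simp [hz0])
  -- The limit is identified through the integral equation, which passes to the limit by dominated
  -- convergence.
  have hint : ∀ t ∈ Icc 0 T, x t = ODE.picard (fun _ => F) 0 x₀ x t := by
    intro t ht
    have hsub : Icc 0 t ⊆ Icc 0 T := Icc_subset_Icc_right ht.2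
    have hzint : ∀ n, z n t = x₀ + ∫ s in (0 : ℝ)..t, H n (z n s) := fun n => by
      have hcont : ContinuousOn (fun s => H n (z n s)) (Icc 0 t) :=
        (hHL n).continuous.comp_continuousOn ((hz n).continuousOn.mono hsub)
      rw [intervalIntegral.integral_eq_sub_of_hasDerivAt_of_le ht.1
        ((hz n).continuousOn.mono hsub)
        (fun s hs => (hz n s (hsub (Ioo_subset_Icc_self hs))).hasDerivAt
          (Icc_mem_nhds hs.1 (hs.2.trans_le ht.2)))
        (hcont.intervalIntegrable_of_Icc ht.1), hz0]
      abel
    have hlimInt : Tendsto (fun n => ∫ s in (0 : ℝ)..t, H n (z n s)) atTop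
        (𝓝 (∫ s in (0 : ℝ)..t, F (x s))) := by
      refine intervalIntegral.tendsto_integral_filter_of_dominated_convergence
        (fun _ => M + 1) (Eventually.of_forall fun n => ?_)
        (Eventually.of_forall fun n => MeasureTheory.ae_of_all _ fun s _ => hHM n _)
        intervalIntegrable_const (MeasureTheory.ae_of_all _ fun s hs => ?_)
      · rw [uIoc_of_le ht.1]
        exact (((hHL n).continuous.comp_continuousOn ((hz n).continuousOn.mono hsub)).mono
          Ioc_subset_Icc_self).aestronglyMeasurable measurableSet_Ioc
      · rw [uIoc_of_le ht.1] at hs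
        have h1 : Tendsto (fun n => F (z n s)) atTop (𝓝 (F (x s))) :=
          (hFc.tendsto _).comp (hx s (hsub (Ioc_subset_Icc_self hs)))
        have h2 : Tendsto (fun n => H n (z n s) - F (z n s)) atTop (𝓝 0) :=
          squeeze_zero_norm (fun n => hHF n _) hlim
        simpa using h2.add h1
    refine tendsto_nhds_unique (hx t ht) ?_
    rw [ODE.picard_apply]
    exact (tendsto_const_nhds.add hlimInt).congr fun n => (hzint n).symm
  refine ⟨x, hx0, fun t ht => ?_⟩
  have := ODE.hasDerivWithinAt_picard_Icc (f := fun _ => F) (α := x) (u := univ) (t₀ := 0)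
    (tmin := 0) (tmax := T) ⟨le_rfl, hT⟩ (hFc.comp continuous_snd).continuousOn hxc
    (fun _ _ => mem_univ _) x₀ ht
  exact this.congr hint (hint t ht)

theorem IsDissipative.exists_isIntegralCurveOn_Ici {F : (V → ℝ) → V → ℝ} (hF : IsDissipative F)
    {x₀ : V → ℝ} (hex : ∀ T : ℝ, 0 ≤ T →
      ∃ x : ℝ → V → ℝ, x 0 = x₀ ∧ IsIntegralCurveOn x (fun _ => F) (Icc 0 T)) :
    ∃ x : ℝ → V → ℝ, x 0 = x₀ ∧ IsIntegralCurveOn x (fun _ => F) (Ici 0) := by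
  choose z hz0 hz using fun N : ℕ => hex (N : ℝ) N.cast_nonneg
  have hagree : ∀ (N M : ℕ) (s : ℝ), 0 ≤ s → s ≤ N → s ≤ M → z N s = z M s :=
    fun N M s hs hN hM => hF.eqOn_Icc ((hz N).mono (Icc_subset_Icc_right hN))
      ((hz M).mono (Icc_subset_Icc_right hM)) ((hz0 N).trans (hz0 M).symm) ⟨hs, le_rfl⟩
  have hxz : ∀ (N : ℕ) (s : ℝ), 0 ≤ s → s ≤ N → z (⌊s⌋₊ + 1) s = z N s := fun N s hs hN =>
    hagree _ _ s hs (by push_cast; exact (Nat.lt_floor_add_one s).le) hN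
  -- The `+ 1` puts `t` strictly before the end of the interval, which is then a neighbourhood of
  -- `t` in `[0, ∞)`.
  refine ⟨fun s => z (⌊s⌋₊ + 1) s, hz0 _, fun t ht => ?_⟩
  have ht0 : (0 : ℝ) ≤ t := ht
  have htN : t < ((⌊t⌋₊ + 1 : ℕ) : ℝ) := by push_cast; exact Nat.lt_floor_add_one t
  have hmem : Icc 0 (((⌊t⌋₊ + 1 : ℕ) : ℝ)) ∈ 𝓝[Ici 0] t := by
    filter_upwards [self_mem_nhdsWithin, nhdsWithin_le_nhds (Iio_mem_nhds htN)] with s hs hs'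
    exact ⟨hs, le_of_lt hs'⟩
  refine ((hz (⌊t⌋₊ + 1) t ⟨ht0, htN.le⟩).mono_of_mem_nhdsWithin hmem).congr_of_eventuallyEq ?_ rfl
  filter_upwards [hmem] with s hs
  exact hxz _ s hs.1 hs.2

end Dissipative

/-! ### Slope bounds and clamped coupling functions. -/

section Consensus

variable {V : Type*} {G : Digraph V} {C : Matrix V V ℝ} {γ : V → V → ℝ → ℝ}

theorem hopfSeminorm_le {x : V → ℝ} {c : ℝ} (hc : 0 ≤ c) (h : ∀ i j, x i - x j ≤ c) :
    hopfSeminorm x ≤ c :=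
  Real.iSup_le (fun p => h p.1 p.2) hc

theorem weight_nonneg (hCpos : ∀ i j, G.Adj i j → 0 < C i j)
    (hCzero : ∀ i j, ¬ G.Adj i j → C i j = 0) (i j : V) : 0 ≤ C i j := by
  by_cases h : G.Adj i j
  exacts [(hCpos i j h).le, (hCzero i j h).ge]

/-- `γ` grows at least at slope `α` between points of `[-w, w]`, along all arcs of `G`. -/
def HasSlopeGeOn (G : Digraph V) (γ : V → V → ℝ → ℝ) (α w : ℝ) : Prop :=
  ∀ i k, G.Adj i k → ∀ s ∈ Icc (-w) w, ∀ t ∈ Icc (-w) w, s ≤ t → α * (t - s) ≤ γ i k t - γ i k s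

/-- The coupling functions `γ`, extended from `[-w, w]` to the line by constants. -/
noncomputable def clamp (γ : V → V → ℝ → ℝ) {w : ℝ} (hw : -w ≤ w) : V → V → ℝ → ℝ :=
  fun i k t => γ i k (projIcc (-w) w hw t)

theorem clamp_of_mem {w : ℝ} (hw : -w ≤ w) {t : ℝ} (ht : t ∈ Icc (-w) w) (i k : V) :
    clamp γ hw i k t = γ i k t := by
  rw [clamp, projIcc_of_mem hw ht]

theorem HasSlopeGeOn.clamp_le {α w : ℝ} (hw : -w ≤ w) (hα : 0 ≤ α) (h : HasSlopeGeOn G γ α w)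
    {i k : V} (hik : G.Adj i k) {s t : ℝ} (hst : s ≤ t) : clamp γ hw i k s ≤ clamp γ hw i k t := by
  have hle : (projIcc (-w) w hw s : ℝ) ≤ projIcc (-w) w hw t := monotone_projIcc hw hst
  have := h i k hik _ (projIcc (-w) w hw s).2 _ (projIcc (-w) w hw t).2 hle
  exact sub_nonneg.1 ((mul_nonneg hα (sub_nonneg.2 hle)).trans this)

theorem HasSlopeGeOn.mono {α w w' : ℝ} (h : HasSlopeGeOn G γ α w) (hw : w' ≤ w) :
    HasSlopeGeOn G γ α w' := fun i k hik s hs t ht =>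
  h i k hik s (Icc_subset_Icc (neg_le_neg hw) hw hs) t (Icc_subset_Icc (neg_le_neg hw) hw ht)

theorem hasSlopeGeOn_of_le_deriv {α w : ℝ} (hd : ∀ i k, G.Adj i k → Differentiable ℝ (γ i k))
    (h : ∀ i k, G.Adj i k → ∀ t ∈ Icc (-w) w, α ≤ deriv (γ i k) t) : HasSlopeGeOn G γ α w :=
  fun i k hik s hs t ht hst =>
    (convex_Icc (-w) w).mul_sub_le_image_sub_of_le_deriv (hd i k hik).continuous.continuousOn
      (hd i k hik).differentiableOn (fun r hr => h i k hik r (interior_subset hr)) s hs t ht hst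

variable [Fintype V]

/-! ### The oscillation seminorm and its decay. -/

theorem sub_le_hopfSeminorm (x : V → ℝ) (i j : V) : x i - x j ≤ hopfSeminorm x :=
  le_ciSup (f := fun p : V × V => x p.1 - x p.2) (finite_range _).bddAbove (i, j)

theorem hopfSeminorm_nonneg (x : V → ℝ) : 0 ≤ hopfSeminorm x := by
  rcases isEmpty_or_nonempty V with hV | ⟨⟨i⟩⟩
  · simp [hopfSeminorm]
  · simpa using sub_le_hopfSeminorm x i i

theorem hopfSeminorm_le_add (x y : V → ℝ) : hopfSeminorm x ≤ hopfSeminorm y + 2 * ‖x - y‖ := by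
  refine hopfSeminorm_le (add_nonneg (hopfSeminorm_nonneg y) (by positivity)) fun i j => ?_
  have h1 := abs_le.1 (norm_le_pi_norm (x - y) i)
  have h2 := abs_le.1 (norm_le_pi_norm (x - y) j)
  simp only [Pi.sub_apply] at h1 h2
  linarith [sub_le_hopfSeminorm y i j, h1.2, h2.1]

theorem continuous_hopfSeminorm : Continuous (hopfSeminorm : (V → ℝ) → ℝ) := by
  refine LipschitzWith.continuous (K := 2) (LipschitzWith.of_le_add_mul _ fun x y => ?_)
  rw [dist_eq_norm]
  exact hopfSeminorm_le_add x y

/-- For `k` other than `i, j`, the nonnegative gaps `x i - x k` and `x k - x j` add up to `x i - x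
j`, so lowering both weights to their minimum leaves that minimum times the oscillation. The indices
`i` and `j` supply `C j i` and `C i j`. -/
theorem sum_sub_sum_le_contractionRate_mul {x : V → ℝ} {i j : V} (hij : i ≠ j)
    (hi : ∀ k, x k ≤ x i) (hj : ∀ k, x j ≤ x k) :
    ∑ k, C i k * (x k - x i) - ∑ k, C j k * (x k - x j) ≤ contractionRate C * (x i - x j) := by
  classical
  have hD : 0 ≤ x i - x j := sub_nonneg.2 (hi j)
  have hfilter : Finset.univ.filter (fun k => k ≠ i ∧ k ≠ j) =
      (Finset.univ.erase i).erase j := by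
    ext k
    simp [and_comm]
  have hinf : -contractionRate C ≤ C i j + C j i +
      ∑ k ∈ (Finset.univ.erase i).erase j, min (C i k) (C j k) := by
    rw [← hfilter, contractionRate, neg_neg]
    refine (ciInf_le (finite_range _).bddBelow
      (⟨(i, j), hij⟩ : {p : V × V // p.1 ≠ p.2})).trans (le_of_eq ?_)
    congr!
  have hsum : (∑ k ∈ (Finset.univ.erase i).erase j, min (C i k) (C j k)) * (x i - x j) ≤
      ∑ k ∈ (Finset.univ.erase i).erase j, (C i k * (x i - x k) + C j k * (x k - x j)) := by
    rw [Finset.sum_mul]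
    refine Finset.sum_le_sum fun k _ => ?_
    have h1 := mul_le_mul_of_nonneg_right (min_le_left (C i k) (C j k)) (sub_nonneg.2 (hi k))
    have h2 := mul_le_mul_of_nonneg_right (min_le_right (C i k) (C j k)) (sub_nonneg.2 (hj k))
    linarith
  have htotal : ∑ k, (C i k * (x i - x k) + C j k * (x k - x j)) =
      C j i * (x i - x j) + (C i j * (x i - x j) +
        ∑ k ∈ (Finset.univ.erase i).erase j, (C i k * (x i - x k) + C j k * (x k - x j))) := by
    rw [← Finset.add_sum_erase _ _ (Finset.mem_univ i),
      ← Finset.add_sum_erase _ _ (Finset.mem_erase.2 ⟨hij.symm, Finset.mem_univ j⟩)]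
    ring
  have hneg : ∑ k, C i k * (x k - x i) - ∑ k, C j k * (x k - x j) =
      -∑ k, (C i k * (x i - x k) + C j k * (x k - x j)) := by
    rw [← Finset.sum_sub_distrib, ← Finset.sum_neg_distrib]
    exact Finset.sum_congr rfl fun k _ => by ring
  have := mul_le_mul_of_nonneg_right hinf hD
  rw [hneg, htotal]
  linarith

theorem consensusField_le_add (hC : ∀ i j, 0 ≤ C i j) (hCzero : ∀ i j, ¬ G.Adj i j → C i j = 0)
    {x : V → ℝ} {i : V} {α : ℝ}
    (h : ∀ k, G.Adj i k → γ i k (x k - x i) ≤ γ i k 0 + α * (x k - x i)) :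
    consensusField G C γ x i ≤ consensusField G C γ 0 i + α * ∑ k, C i k * (x k - x i) := by
  classical
  simp only [consensusField, Finset.sum_filter, Finset.mul_sum, ← Finset.sum_add_distrib]
  refine Finset.sum_le_sum fun k _ => ?_
  split_ifs with hk
  · have := mul_le_mul_of_nonneg_left (h k hk) (hC i k)
    simp only [Pi.zero_apply, sub_zero]
    linarith
  · simp [hCzero i k hk]

theorem add_le_consensusField (hC : ∀ i j, 0 ≤ C i j) (hCzero : ∀ i j, ¬ G.Adj i j → C i j = 0)
    {x : V → ℝ} {i : V} {α : ℝ}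
    (h : ∀ k, G.Adj i k → γ i k 0 + α * (x k - x i) ≤ γ i k (x k - x i)) :
    consensusField G C γ 0 i + α * ∑ k, C i k * (x k - x i) ≤ consensusField G C γ x i := by
  classical
  simp only [consensusField, Finset.sum_filter, Finset.mul_sum, ← Finset.sum_add_distrib]
  refine Finset.sum_le_sum fun k _ => ?_
  split_ifs with hk
  · have := mul_le_mul_of_nonneg_left (h k hk) (hC i k)
    simp only [Pi.zero_apply, sub_zero]
    linarith
  · simp [hCzero i k hk]

theorem hopfSeminorm_le_exp_of_isIntegralCurveOn (hC : ∀ i j, 0 ≤ C i j)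
    (hCzero : ∀ i j, ¬ G.Adj i j → C i j = 0)
    (hline : ∀ i j, consensusField G C γ 0 i = consensusField G C γ 0 j)
    {α T : ℝ} (hα : 0 ≤ α) {x : ℝ → V → ℝ}
    (hx : IsIntegralCurveOn x (fun _ => consensusField G C γ) (Icc 0 T))
    (hγ : ∀ t ∈ Ico 0 T, HasSlopeGeOn G γ α (hopfSeminorm (x t)))
    {t : ℝ} (ht : t ∈ Icc 0 T) :
    hopfSeminorm (x t) ≤ Real.exp (contractionRate C * α * t) * hopfSeminorm (x 0) := by
  refine hopfSeminorm_le (mul_nonneg (Real.exp_pos _).le (hopfSeminorm_nonneg _)) fun i j => ?_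
  have := le_gronwallBound_of_active (u := fun (p : V × V) t => x t p.1 - x t p.2)
    (u' := fun p t => consensusField G C γ (x t) p.1 - consensusField G C γ (x t) p.2)
    (δ := hopfSeminorm (x 0)) (K := contractionRate C * α) (ε := 0) (T := T)
    (fun p => ((continuous_apply p.1).comp_continuousOn hx.continuousOn).sub
      ((continuous_apply p.2).comp_continuousOn hx.continuousOn))
    (fun p s hs => by
      have h := hasDerivWithinAt_pi.1
        (hasDerivWithinAt_Ici_of_Icc hs (hx s (Ico_subset_Icc_self hs)))
      exact (h p.1).sub (h p.2))
    (fun p => sub_le_hopfSeminorm _ _ _) ?_ ht (i, j)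
  · rwa [gronwallBound_ε0, mul_comm] at this
  · rintro s hs ⟨a, b⟩ hab
    have hmax : ∀ k, x s k ≤ x s a := fun k => by have := hab (k, b); simpa using this
    have hmin : ∀ k, x s b ≤ x s k := fun k => by have := hab (a, k); dsimp only at this; linarith
    -- A diagonal pair is outside the minimum in `contractionRate`, but its difference vanishes
    -- identically.
    by_cases hne : a = b
    · subst hne
      simp
    have hD := hopfSeminorm_nonneg (x s)
    have h0 : (0 : ℝ) ∈ Icc (-hopfSeminorm (x s)) (hopfSeminorm (x s)) :=
      ⟨neg_nonpos.2 hD, hD⟩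
    have hmem : ∀ k l, x s k - x s l ∈ Icc (-hopfSeminorm (x s)) (hopfSeminorm (x s)) :=
      fun k l => ⟨by linarith [sub_le_hopfSeminorm (x s) l k], sub_le_hopfSeminorm _ _ _⟩
    have h1 := consensusField_le_add (γ := γ) (i := a) (x := x s) (α := α) hC hCzero
      fun k hk => by
        have := hγ s hs a k hk _ (hmem k a) 0 h0 (sub_nonpos.2 (hmax k))
        linarith
    have h2 := add_le_consensusField (γ := γ) (i := b) (x := x s) (α := α) hC hCzero
      fun k hk => by
        have := hγ s hs b k hk 0 h0 _ (hmem k b) (sub_nonneg.2 (hmin k))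
        linarith
    have h3 := mul_le_mul_of_nonneg_left (sum_sub_sum_le_contractionRate_mul (C := C) hne hmax hmin) hα
    have h4 := hline a b
    simp only
    linarith

/-! ### Lipschitz approximation and global existence after clamping. -/

theorem exists_lipschitzWith_near {g : ℝ → ℝ} {w : ℝ} (hw : -w ≤ w)
    (hg : ContinuousOn g (Icc (-w) w)) {ε : ℝ} (hε : 0 < ε) :
    ∃ (K : NNReal) (q : ℝ → ℝ), LipschitzWith K q ∧
      ∀ t, |q t - g (projIcc (-w) w hw t)| ≤ ε := by
  obtain ⟨p, hp⟩ := exists_polynomial_near_of_continuousOn (-w) w g hg ε hε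
  obtain ⟨K, hK⟩ := (p.contDiff_aeval (𝕜 := ℝ) 1).contDiffOn.exists_lipschitzOnWith one_ne_zero
    (convex_Icc (-w) w) isCompact_Icc
  -- Precomposing with the 1-Lipschitz projection makes the polynomial's Lipschitz constant on the
  -- interval global.
  refine ⟨K, fun t => p.aeval (projIcc (-w) w hw t : ℝ), LipschitzWith.of_dist_le_mul fun s t => ?_,
    fun t => by simpa using (hp _ (projIcc (-w) w hw t).2).le⟩
  refine (hK.dist_le_mul _ (projIcc (-w) w hw s).2 _ (projIcc (-w) w hw t).2).trans
    (mul_le_mul_of_nonneg_left ?_ K.2)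
  simpa [Subtype.dist_eq] using (LipschitzWith.projIcc hw).dist_le_mul s t

theorem norm_consensusField_sub_le (hC : ∀ i j, 0 ≤ C i j) {γ' : V → V → ℝ → ℝ} {x y : V → ℝ}
    {b : V → V → ℝ} (hb : ∀ i k, 0 ≤ b i k)
    (h : ∀ i k, G.Adj i k → |γ i k (x k - x i) - γ' i k (y k - y i)| ≤ b i k) :
    ‖consensusField G C γ x - consensusField G C γ' y‖ ≤ ∑ i, ∑ k, C i k * b i k := by
  classical
  have hrow : ∀ i, 0 ≤ ∑ k, C i k * b i k := fun i =>
    Finset.sum_nonneg fun k _ => mul_nonneg (hC i k) (hb i k)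
  refine (pi_norm_le_iff_of_nonneg (Finset.sum_nonneg fun i _ => hrow i)).2 fun i => ?_
  refine le_trans ?_ (Finset.single_le_sum (fun i _ => hrow i) (Finset.mem_univ i))
  simp only [consensusField, Pi.sub_apply, Finset.sum_filter, ← Finset.sum_sub_distrib]
  refine (norm_sum_le _ _).trans (Finset.sum_le_sum fun k _ => ?_)
  split_ifs with hk
  · rw [← mul_sub, norm_mul, Real.norm_eq_abs, Real.norm_eq_abs, abs_of_nonneg (hC i k)]
    exact mul_le_mul_of_nonneg_left (h i k hk) (hC i k)
  · simpa using mul_nonneg (hC i k) (hb i k)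

theorem consensusField_clamp {w : ℝ} (hw : -w ≤ w) {x : V → ℝ} (hx : hopfSeminorm x ≤ w) :
    consensusField G C (clamp γ hw) x = consensusField G C γ x := by
  funext i
  refine Finset.sum_congr rfl fun k _ => ?_
  rw [clamp_of_mem]
  exact ⟨by linarith [sub_le_hopfSeminorm x i k], by linarith [sub_le_hopfSeminorm x k i]⟩

theorem isDissipative_consensusField (hC : ∀ i j, 0 ≤ C i j)
    (hγ : ∀ i k, G.Adj i k → Monotone (γ i k)) : IsDissipative (consensusField G C γ) := by
  classical
  intro x y i hi
  refine Finset.sum_le_sum fun k hk => mul_le_mul_of_nonneg_left ?_ (hC i k)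
  exact hγ i k (Finset.mem_filter.1 hk).2 (by linarith [hi k])

theorem exists_lipschitzWith_consensusField_near (hC : ∀ i j, 0 ≤ C i j) {w : ℝ} (hw : -w ≤ w)
    (hγ : ∀ i k, G.Adj i k → Continuous (γ i k)) {ε : ℝ} (hε : 0 < ε) :
    ∃ (K : NNReal) (H : (V → ℝ) → V → ℝ), LipschitzWith K H ∧
      ∀ x, ‖H x - consensusField G C (clamp γ hw) x‖ ≤ ε := by
  set S : ℝ := ∑ i, ∑ k, C i k with hS
  have hS0 : 0 ≤ S := Finset.sum_nonneg fun i _ => Finset.sum_nonneg fun k _ => hC i k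
  -- The `+ 1` covers the case of vanishing total weight.
  have hη : 0 < ε / (S + 1) := by positivity
  have hq : ∀ i k, ∃ (K : NNReal) (q : ℝ → ℝ), G.Adj i k → LipschitzWith K q ∧
      ∀ t, |q t - clamp γ hw i k t| ≤ ε / (S + 1) := fun i k => by
    by_cases h : G.Adj i k
    · obtain ⟨K, q, hq⟩ := exists_lipschitzWith_near hw (hγ i k h).continuousOn hη
      exact ⟨K, q, fun _ => hq⟩
    · exact ⟨0, 0, fun h' => absurd h' h⟩
  choose K q hq using hq
  refine ⟨(∑ i, ∑ k, C i k * (K i k * 2)).toNNReal, consensusField G C q,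
    LipschitzWith.of_dist_le_mul fun x y => ?_, fun x => ?_⟩
  · rw [dist_eq_norm, dist_eq_norm, Real.coe_toNNReal _ (Finset.sum_nonneg fun i _ =>
      Finset.sum_nonneg fun k _ => mul_nonneg (hC i k) (by positivity))]
    refine (norm_consensusField_sub_le (b := fun i k => K i k * 2 * ‖x - y‖) hC
      (fun i k => by positivity) fun i k hik => ?_).trans (le_of_eq ?_)
    · refine ((hq i k hik).1.norm_sub_le _ _).trans ?_
      rw [mul_assoc]
      refine mul_le_mul_of_nonneg_left ?_ (K i k).2
      have h1 := norm_le_pi_norm (x - y) i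
      have h2 := norm_le_pi_norm (x - y) k
      have h3 := norm_sub_le ((x - y) k) ((x - y) i)
      have h4 : x k - x i - (y k - y i) = (x - y) k - (x - y) i := by
        simp only [Pi.sub_apply]
        ring
      rw [h4]
      linarith
    · simp only [Finset.sum_mul, mul_assoc]
  · refine (norm_consensusField_sub_le (b := fun _ _ => ε / (S + 1)) hC (fun _ _ => hη.le)
      fun i k hik => (hq i k hik).2 _).trans ?_
    simp only [← Finset.sum_mul, ← hS]
    rw [mul_div_assoc', div_le_iff₀ (by linarith)]
    nlinarith

theorem exists_isIntegralCurveOn_Ici_clamp (hC : ∀ i j, 0 ≤ C i j) {w : ℝ} (hw : -w ≤ w)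
    (hγ : ∀ i k, G.Adj i k → Continuous (γ i k))
    (hF : IsDissipative (consensusField G C (clamp γ hw))) (x₀ : V → ℝ) :
    ∃ x : ℝ → V → ℝ, x 0 = x₀ ∧
      IsIntegralCurveOn x (fun _ => consensusField G C (clamp γ hw)) (Ici 0) := by
  have hcont : Continuous (consensusField G C (clamp γ hw)) := by
    classical
    refine continuous_pi fun i => continuous_finsetSum _ fun k hk => continuous_const.mul ?_
    exact (hγ i k (Finset.mem_filter.1 hk).2).comp (continuous_subtype_val.comp
      (continuous_projIcc.comp ((continuous_apply k).sub (continuous_apply i))))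
  have hbound : ∀ i k, ∃ B : ℝ, 0 ≤ B ∧ (G.Adj i k → ∀ t, |clamp γ hw i k t| ≤ B) := fun i k => by
    by_cases h : G.Adj i k
    · obtain ⟨B, hB⟩ := isCompact_Icc.exists_bound_of_continuousOn
        (hγ i k h).continuousOn (s := Icc (-w) w)
      exact ⟨B, (norm_nonneg _).trans (hB w ⟨hw, le_rfl⟩), fun _ t => hB _ (projIcc _ _ hw t).2⟩
    · exact ⟨0, le_rfl, fun h' => absurd h' h⟩
  choose B hB0 hB using hbound
  have hM : ∀ x, ‖consensusField G C (clamp γ hw) x‖ ≤ ∑ i, ∑ k, C i k * B i k := fun x => by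
    have h0 : consensusField G C (fun _ _ _ => 0) (0 : V → ℝ) = 0 := by
      funext i
      simp [consensusField]
    have := norm_consensusField_sub_le (G := G) (γ := clamp γ hw) (γ' := fun _ _ _ => 0) (x := x)
      (y := 0) hC hB0 fun i k hik => by simpa using hB i k hik (x k - x i)
    rwa [h0, sub_zero] at this
  exact hF.exists_isIntegralCurveOn_Ici fun T hT => hF.exists_isIntegralCurveOn_Icc hcont hM
    (fun ε hε => exists_lipschitzWith_consensusField_near hC hw hγ hε) x₀ hT

theorem solutionContractsAtRate_of_hasSlopeGeOn (hC : ∀ i j, 0 ≤ C i j)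
    (hCzero : ∀ i j, ¬ G.Adj i j → C i j = 0) (hγc : ∀ i k, G.Adj i k → Continuous (γ i k))
    {α w : ℝ} (hα : 0 ≤ α) (hγ : HasSlopeGeOn G γ α w)
    (hline : ∀ i j, consensusField G C γ 0 i = consensusField G C γ 0 j)
    {x₀ : V → ℝ} (hx₀ : hopfSeminorm x₀ < w) :
    SolutionContractsAtRate (consensusField G C γ) x₀ (contractionRate C * α) := by
  have hw0 : 0 < w := (hopfSeminorm_nonneg x₀).trans_lt hx₀
  have hw : -w ≤ w := by linarith
  have hmono : ∀ i k, G.Adj i k → Monotone (clamp γ hw i k) :=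
    fun i k hik s t hst => hγ.clamp_le hw hα hik hst
  have hF : IsDissipative (consensusField G C (clamp γ hw)) := isDissipative_consensusField hC hmono
  obtain ⟨x, hx0, hx⟩ := exists_isIntegralCurveOn_Ici_clamp hC hw hγc hF x₀
  have hzero : consensusField G C (clamp γ hw) 0 = consensusField G C γ 0 :=
    consensusField_clamp hw (hopfSeminorm_le hw0.le fun i j => by simpa using hw0.le)
  -- The choice `α = 0` avoids circularity: the clamped functions have nonnegative slope everywhere,
  -- so no prior bound on the oscillation is needed.
  have hosc : ∀ t, 0 ≤ t → hopfSeminorm (x t) ≤ hopfSeminorm x₀ := fun t ht => by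
    have := hopfSeminorm_le_exp_of_isIntegralCurveOn (α := 0) (T := t) hC hCzero
      (by rwa [hzero]) le_rfl (hx.mono Icc_subset_Ici_self)
      (fun s _ i k hik a _ b _ hab => by simpa using hmono i k hik hab) ⟨ht, le_rfl⟩
    simpa [hx0] using this
  have hxγ : IsIntegralCurveOn x (fun _ => consensusField G C γ) (Ici 0) := fun t ht => by
    have := hx t ht
    dsimp only at this ⊢
    rwa [consensusField_clamp hw ((hosc t ht).trans hx₀.le)] at this
  refine ⟨x, hx0, hxγ, fun T y hy0 hy => ?_, fun t ht => ?_⟩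
  · have huniq : ∀ s ∈ Ico 0 T, (∀ t ∈ Icc 0 s, hopfSeminorm (y t) ≤ w) → y s = x s := by
      intro s hs hys
      refine hF.eqOn_Icc (T := s) (fun t ht => ?_) (hx.mono Icc_subset_Ici_self)
        (hy0.trans hx0.symm) ⟨hs.1, le_rfl⟩
      have := (hy.mono (Icc_subset_Ico_right hs.2)) t ht
      dsimp only at this ⊢
      rwa [← consensusField_clamp hw (hys t ht)] at this
    intro s hs
    refine huniq s hs ?_
    by_contra! hex
    have hcont : ContinuousOn (fun t => hopfSeminorm (y t)) (Icc 0 s) :=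
      continuous_hopfSeminorm.comp_continuousOn
        (hy.continuousOn.mono (Icc_subset_Ico_right hs.2))
    -- Let `a` be the first time the oscillation of `y` reaches `w`. Before `a`, `y` agrees with
    -- `x`, so by continuity its oscillation at `a` is at most the initial one, below `w`.
    have hcomp : IsCompact (Icc 0 s ∩ (fun t => hopfSeminorm (y t)) ⁻¹' Ici w) :=
      isCompact_Icc.of_isClosed_subset
        (hcont.preimage_isClosed_of_isClosed isClosed_Icc isClosed_Ici) inter_subset_left
    obtain ⟨t, ht, hyt⟩ := hex
    obtain ⟨a, ⟨ha, hwa⟩, hleast⟩ := hcomp.exists_isLeast ⟨t, ht, hyt.le⟩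
    have hbelow : ∀ t ∈ Ico 0 a, hopfSeminorm (y t) < w := fun t ht => by
      by_contra! h
      exact absurd (hleast ⟨⟨ht.1, ht.2.le.trans ha.2⟩, h⟩) (not_le.2 ht.2)
    have haT : a ∈ Ico 0 T := ⟨ha.1, ha.2.trans_lt hs.2⟩
    have heq : ∀ t ∈ Ico 0 a, y t = x t := fun t ht =>
      huniq t ⟨ht.1, ht.2.trans haT.2⟩ fun r hr => (hbelow r ⟨hr.1, hr.2.trans_lt ht.2⟩).le
    have hle : hopfSeminorm (y a) ≤ hopfSeminorm x₀ := by
      rcases ha.1.eq_or_lt with h | h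
      · rw [← h, hy0]
      · have hclos : a ∈ closure (Ico 0 a) := by
          rw [closure_Ico h.ne]
          exact right_mem_Icc.2 h.le
        have := hcont.mono (Icc_subset_Icc_right ha.2)
        refine ContinuousWithinAt.closure_le hclos
          ((this a (right_mem_Icc.2 h.le)).mono Ico_subset_Icc_self)
          continuousWithinAt_const fun r hr => ?_
        rw [heq r hr]
        exact hosc r hr.1
    exact absurd (hle.trans_lt hx₀) (not_lt.2 hwa)
  · have := hopfSeminorm_le_exp_of_isIntegralCurveOn (T := t) hC hCzero hline hα
      (hxγ.mono Icc_subset_Ici_self)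
      (fun s hs => hγ.mono ((hosc s hs.1).trans hx₀.le)) ⟨ht, le_rfl⟩
    rwa [hx0] at this

/-- By uniqueness the solutions for all parameters coincide, so one curve satisfies every bound and
the limit can be taken pointwise in time. -/
theorem SolutionContractsAtRate.of_tendsto {φ : (V → ℝ) → V → ℝ} {x₀ : V → ℝ} {ι : Type*}
    {l : Filter ι} [l.NeBot] {r : ι → ℝ} {ρ : ℝ}
    (h : ∀ᶠ w in l, SolutionContractsAtRate φ x₀ (r w)) (hr : Tendsto r l (𝓝 ρ)) :
    SolutionContractsAtRate φ x₀ ρ := by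
  obtain ⟨w, x, hx0, hx, huniq, -⟩ := h.exists
  refine ⟨x, hx0, hx, huniq, fun t ht => ?_⟩
  refine ge_of_tendsto (((hr.mul_const t).rexp).mul_const (hopfSeminorm x₀)) ?_
  filter_upwards [h] with v hv
  obtain ⟨y, hy0, hy, -, hbound⟩ := hv
  have := huniq (t + 1) y hy0 (hy.mono Ico_subset_Ici_self) ⟨ht, lt_add_one t⟩
  exact this ▸ hbound t ht

theorem hopfSeminorm_lt {x : V → ℝ} {c : ℝ} (hc : 0 < c) (h : ∀ i j, x i - x j < c) :
    hopfSeminorm x < c := by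
  rcases isEmpty_or_nonempty V with hV | hV
  · simpa [hopfSeminorm] using hc
  · obtain ⟨p, hp⟩ := exists_eq_ciSup_of_finite (f := fun p : V × V => x p.1 - x p.2)
    rw [hopfSeminorm, ← hp]
    exact h p.1 p.2

theorem solutionContractsAtRate_sin (hC : ∀ i j, 0 ≤ C i j) (hCzero : ∀ i j, ¬ G.Adj i j → C i j = 0)
    {w : ℝ} (hw : w < Real.pi / 2) {θ₀ : V → ℝ} (hθ₀ : hopfSeminorm θ₀ < w) :
    SolutionContractsAtRate (consensusField G C (fun _ _ => Real.sin)) θ₀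
      (contractionRate C * Real.cos w) := by
  have hw0 : 0 ≤ w := (hopfSeminorm_nonneg θ₀).trans hθ₀.le
  refine solutionContractsAtRate_of_hasSlopeGeOn hC hCzero (fun _ _ _ => Real.continuous_sin)
    (Real.cos_nonneg_of_mem_Icc ⟨by linarith, hw.le⟩)
    (hasSlopeGeOn_of_le_deriv (fun _ _ _ => Real.differentiable_sin) fun _ _ _ t ht => ?_)
    (fun i j => by simp [consensusField]) hθ₀
  rw [Real.deriv_sin, ← Real.cos_abs t]
  exact Real.cos_le_cos_of_nonneg_of_le_pi (abs_nonneg t) (by linarith [Real.pi_pos])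
    (abs_le.2 ht)

theorem solutionContractsAtRate_arctan (hC : ∀ i j, 0 ≤ C i j)
    (hCzero : ∀ i j, ¬ G.Adj i j → C i j = 0)
    {w : ℝ} {x₀ : V → ℝ} (hx₀ : hopfSeminorm x₀ < w) :
    SolutionContractsAtRate (consensusField G C (fun _ _ => Real.arctan)) x₀
      (contractionRate C * (1 / (1 + w ^ 2))) := by
  refine solutionContractsAtRate_of_hasSlopeGeOn hC hCzero (fun _ _ _ => Real.continuous_arctan)
    (by positivity)
    (hasSlopeGeOn_of_le_deriv (fun _ _ _ => Real.differentiable_arctan) fun _ _ _ t ht => ?_)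
    (fun i j => by simp [consensusField]) hx₀
  rw [Real.deriv_arctan]
  exact one_div_le_one_div_of_le (by positivity) (by linarith [sq_le_sq' ht.1 ht.2])

end Consensus

end NonlinearConsensus

theorem mainTheorem12 {V : Type*} [Fintype V] (G : Digraph V) (C : Matrix V V ℝ)
    (hCpos : ∀ i j, G.Adj i j → 0 < C i j) (hCzero : ∀ i j, ¬ G.Adj i j → C i j = 0) :
    -- the nonlinear consensus protocol
    (∀ (γ : V → V → ℝ → ℝ) (w α : ℝ), 0 < w → 0 ≤ α →
      (∀ i k, G.Adj i k → Differentiable ℝ (γ i k)) →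
      (∀ i k, G.Adj i k → ∀ t ∈ Set.Icc (-w) w, α ≤ deriv (γ i k) t) →
      -- the line of consensus states is invariant
      (∀ i j, NonlinearConsensus.consensusField G C γ 0 i =
        NonlinearConsensus.consensusField G C γ 0 j) →
      ∀ x₀ : V → ℝ, NonlinearConsensus.hopfSeminorm x₀ < w →
        NonlinearConsensus.SolutionContractsAtRate
          (NonlinearConsensus.consensusField G C γ) x₀
          (NonlinearConsensus.contractionRate C * α)) ∧
    -- the Kuramoto equation
    (∀ w : ℝ, 0 < w → w < Real.pi / 2 →
      ∀ θ₀ : V → ℝ, NonlinearConsensus.hopfSeminorm θ₀ < w →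
        NonlinearConsensus.SolutionContractsAtRate
          (NonlinearConsensus.consensusField G C (fun _ _ => Real.sin)) θ₀
          (NonlinearConsensus.contractionRate C * Real.cos w)) ∧
    (∀ θ₀ : V → ℝ, (∀ i, θ₀ i ∈ Set.Ioo (-(Real.pi / 4)) (Real.pi / 4)) →
        NonlinearConsensus.SolutionContractsAtRate
          (NonlinearConsensus.consensusField G C (fun _ _ => Real.sin)) θ₀
          (NonlinearConsensus.contractionRate C *
            Real.cos (NonlinearConsensus.hopfSeminorm θ₀))) ∧
    -- the arctangent protocol
    (∀ x₀ : V → ℝ,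
        NonlinearConsensus.SolutionContractsAtRate
          (NonlinearConsensus.consensusField G C (fun _ _ => Real.arctan)) x₀
          (NonlinearConsensus.contractionRate C /
            (1 + NonlinearConsensus.hopfSeminorm x₀ ^ 2))) := by

  have hC := NonlinearConsensus.weight_nonneg hCpos hCzero
  refine ⟨fun γ w α _ hα hd hderiv hline x₀ hx₀ => ?_, fun w _ hw θ₀ hθ₀ => ?_, fun θ₀ hθ₀ => ?_,
    fun x₀ => ?_⟩
  · exact NonlinearConsensus.solutionContractsAtRate_of_hasSlopeGeOn hC hCzero
      (fun i k hik => (hd i k hik).continuous) hα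
      (NonlinearConsensus.hasSlopeGeOn_of_le_deriv hd hderiv) hline hx₀
  · exact NonlinearConsensus.solutionContractsAtRate_sin hC hCzero hw hθ₀
  · have hlt : NonlinearConsensus.hopfSeminorm θ₀ < Real.pi / 2 :=
      NonlinearConsensus.hopfSeminorm_lt (by positivity)
        fun i j => by linarith [(hθ₀ i).2, (hθ₀ j).1]
    -- The sine estimate needs the oscillation strictly below `w`, so its endpoint rate is a limit
    -- from the right.
    refine NonlinearConsensus.SolutionContractsAtRate.of_tendsto
      (l := nhdsWithin (NonlinearConsensus.hopfSeminorm θ₀)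
        (Set.Ioi (NonlinearConsensus.hopfSeminorm θ₀)))
      (r := fun w => NonlinearConsensus.contractionRate C * Real.cos w) ?_
      ((Continuous.tendsto (by fun_prop) _).mono_left nhdsWithin_le_nhds)
    filter_upwards [Ioo_mem_nhdsGT hlt] with w hw
    exact NonlinearConsensus.solutionContractsAtRate_sin hC hCzero hw.2 hw.1
  · rw [div_eq_mul_one_div]
    refine NonlinearConsensus.SolutionContractsAtRate.of_tendsto
      (l := nhdsWithin (NonlinearConsensus.hopfSeminorm x₀)
        (Set.Ioi (NonlinearConsensus.hopfSeminorm x₀)))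
      (r := fun w => NonlinearConsensus.contractionRate C * (1 / (1 + w ^ 2))) ?_
      ((Continuous.tendsto (continuous_const.mul (continuous_const.div (by fun_prop)
        fun w => by positivity)) _).mono_left nhdsWithin_le_nhds)
    filter_upwards [self_mem_nhdsWithin] with w hw
    exact NonlinearConsensus.solutionContractsAtRate_arctan hC hCzero hw
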